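/- Let $g,d\in\mathbb N$, and let $\bar\sigma$ be an invertible density matrix in $\mathcal M_d(\mathbb C)$ (positive definite, trace one). Let $\mathcal Q_{\bar\sigma}(g,2^{\times g},d)$ be the set of dichotomic assemblages with average $\bar\sigma$, i.e. families $\boldsymbol\sigma=(\sigma_{a|x})_{a\in[2],\,x\in[g]}$ of positive semidefinite complex $d\times d$ matrices with $\sum_{a}\sigma_{a|x}=\bar\sigma$ for every $x\in[g]$. Let $\mathcal L_{\bar\sigma}(g,2^{\times g},d)$ be the set of those families of positive semidefinite matrices that admit a local hidden state (LHS) model with average $\bar\sigma$: there are a finite set $\Lambda$, a probability distribution $(q_\lambda)_{\lambda\in\Lambda}$, conditional probabilities $p(a|x,\lambda)$ (nonnegative, $\sum_a p(a|x,\lambda)=1$) and density matrices $\sigma_\lambda$ such that $\sigma_{a|x}=\sum_\lambda q_\lambda\,p(a|x,\lambda)\,\sigma_\lambda$ for all $a,x$, and $\sum_\lambda q_\lambda\sigma_\lambda=\bar\sigma$. Let $\boldsymbol{\bar\sigma}$ be the trivial assemblage, all of whose elements are $\bar\sigma/2$; for $\mathbf s\in[0,1]^g$ let $\mathbf s.\boldsymbol\sigma+(\mathbf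 1-\mathbf s).\boldsymbol{\bar\sigma}$ be the assemblage with elements $s_x\sigma_{a|x}+(1-s_x)\bar\sigma/2$. For a $g$-tuple $\mathbf B$ of self-adjoint complex $d\times d$ matrices let $\mathcal D_{\mathbf B}(n)$ be the set of $g$-tuples $\mathbf X$ of self-adjoint complex $n\times n$ matrices with $\sum_i B_i\otimes X_i\le I$ (in the positive semidefinite order), and let $\mathcal D_{\square,g}(n)$ (the matrix cube) be the set of $g$-tuples of self-adjoint complex $n\times n$ matrices with operator norms $\|X_i\|_\infty\le 1$. Let $\Delta_\square(g,d)$ be the set of all $\mathbf s\in[0,1]^g$ such that, for every $g$-tuple $\mathbf B$ of self-adjoint complex $d\times d$ matrices, if $\mathcal D_{\square,g}(1)\subseteq\mathcal D_{\mathbf B}(1)$, then $(s_1X_1,\dots,s_gX_g)\in\mathcal D_{\mathbf B}(n)$ for all $n\in\mathbb N$ and all $\mathbf X\in\mathcal D_{\square,g}(n)$. Then $$\{\mathbf s\in[0,1]^g:\ \mathbf s.\mathcal Q_{\bar\sigma}(g,2^{\times g},d)+(\mathbf 1-\mathbf s).\boldsymbol{\bar\sigma}\subseteq\mathcal L_{\bar\sigma}(g,2^{\times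 g},d)\}=\Delta_\square(g,d).$$ -/

import Mathlib

open scoped Kronecker ComplexOrder

namespace Steering

/-- A density matrix: positive semidefinite with trace one. -/
def IsDensityMatrix {d : ℕ} (ρ : Matrix (Fin d) (Fin d) ℂ) : Prop :=
  ρ.PosSemidef ∧ ρ.trace = 1

/-- Families `(σ_{a|x})` of complex `d × d` matrices, where `x` runs over the `g` inputs and
`a` over the `k x` outcomes of the input `x`. -/
abbrev Family (g : ℕ) (k : Fin g → ℕ) (d : ℕ) : Type :=
  (x : Fin g) → Fin (k x) → Matrix (Fin d) (Fin d) ℂ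

/-- The set of `(g, k, d)`-assemblages with average `σbar`. -/
def assemblages (g : ℕ) (k : Fin g → ℕ) (d : ℕ) (σbar : Matrix (Fin d) (Fin d) ℂ) :
    Set (Family g k d) :=
  {σ | (∀ x a, (σ x a).PosSemidef) ∧ ∀ x, ∑ a, σ x a = σbar}

/-- The set of `(g, k, d)`-assemblages that admit a local hidden state model whose ensemble
`{q_l, τ_l}` has average `σbar`; the number `p x a l` is the conditional probability of the
outcome `a` given the input `x` and the hidden variable `l`. -/
def lhsAssemblages (g : ℕ) (k : Fin g → ℕ) (d : ℕ) (σbar : Matrix (Fin d) (Fin d) ℂ) :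
    Set (Family g k d) :=
  {σ | (∀ x a, (σ x a).PosSemidef) ∧
    ∃ (Λ : Type) (_ : Fintype Λ) (q : Λ → ℝ) (p : (x : Fin g) → Fin (k x) → Λ → ℝ)
      (τ : Λ → Matrix (Fin d) (Fin d) ℂ),
      (∀ l, 0 ≤ q l) ∧ ∑ l, q l = 1 ∧
      (∀ x a l, 0 ≤ p x a l) ∧ (∀ x l, ∑ a, p x a l = 1) ∧
      (∀ l, IsDensityMatrix (τ l)) ∧
      (∀ x a, σ x a = ∑ l, (q l * p x a l) • τ l) ∧
      ∑ l, q l • τ l = σbar}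

/-- The trivial assemblage `σ_{a|x} = σbar / k_x`. -/
noncomputable def trivialAssemblage (g : ℕ) (k : Fin g → ℕ) (d : ℕ)
    (σbar : Matrix (Fin d) (Fin d) ℂ) : Family g k d :=
  fun x _ => ((k x : ℝ)⁻¹) • σbar

/-- The mixture `s.σ + (1 - s).τ`, the weight `s x` being used for all outcomes of the
input `x`. -/
noncomputable def mix {g : ℕ} {k : Fin g → ℕ} {d : ℕ} (s : Fin g → ℝ) (σ τ : Family g k d) :
    Family g k d :=
  fun x a => s x • σ x a + (1 - s x) • τ x a

/-- The level `n` of the monic free spectrahedron of a `g`-tuple `B` of `d × d` matrices: the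
`g`-tuples `X` of self-adjoint `n × n` matrices with `∑ i, B i ⊗ X i ≤ I`. -/
def freeSpectrahedron {g d : ℕ} (B : Fin g → Matrix (Fin d) (Fin d) ℂ) (n : ℕ) :
    Set (Fin g → Matrix (Fin n) (Fin n) ℂ) :=
  {X | (∀ i, (X i).IsHermitian) ∧
    ((1 : Matrix (Fin d × Fin n) (Fin d × Fin n) ℂ) - ∑ i, B i ⊗ₖ X i).PosSemidef}

/-- The level `n` of the complex matrix cube: `g`-tuples of self-adjoint `n × n` matrices whose
operator norms (on `ℂⁿ` with the Euclidean norm) are at most one. -/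
def matrixCube (g n : ℕ) : Set (Fin g → Matrix (Fin n) (Fin n) ℂ) :=
  {X | ∀ i, (X i).IsHermitian ∧ ‖Matrix.toEuclideanCLM (𝕜 := ℂ) (X i)‖ ≤ 1}

/-- The set of inclusion constants in dimension `d` of the family `D` of levels `D n`, for the
inclusion into monic free spectrahedra. -/
def inclusionConstants {g : ℕ} (D : (n : ℕ) → Set (Fin g → Matrix (Fin n) (Fin n) ℂ)) (d : ℕ) :
    Set (Fin g → ℝ) :=
  {s | (∀ i, s i ∈ Set.Icc (0 : ℝ) 1) ∧
    ∀ B : Fin g → Matrix (Fin d) (Fin d) ℂ, (∀ i, (B i).IsHermitian) →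
      D 1 ⊆ freeSpectrahedron B 1 →
      ∀ n : ℕ, (fun (X : Fin g → Matrix (Fin n) (Fin n) ℂ) i => s i • X i) '' D n ⊆
        freeSpectrahedron B n}

/-- The inclusion constants `Δ_□(g, d)` of the matrix cube. -/
def cubeInclusionConstants (g d : ℕ) : Set (Fin g → ℝ) :=
  inclusionConstants (matrixCube g) d

end Steering

/-! Write `P` for the average. A dichotomic assemblage is determined by its differences `Y x = σ x 0
- σ x 1`, subject to `-P ≤ Y x ≤ P`; noise multiplies `Y x` by `s x`, and a local hidden state model
decomposes `(P, s.Y)` into points `(H, t.H)` with `H ≥ 0` and `t` in the cube (`mix_subset_iff`).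
These points generate a closed cone, whose dual consists of the `(C, -B)` with `C - ∑ t i • B i ≥ 0`
on the cube (`exists_separation`, `HasHiddenModel.sum_trace_le`). For `C = 1` this is, up to
transposes, the level-one inclusion (`matrixCube_one_subset_iff`), while membership at level `n` is
the dual inequality for the pairs `(Vᴴ V, Vᴴ X V)` (`mem_freeSpectrahedron_iff`). Congruences
normalise `C` to `1` and carry `Vᴴ V` to `P`. They need invertible matrices: `P` is one by
hypothesis, the others become so after adding `δ • 1`. -/

namespace Steering

open Matrix
open scoped Matrix.Norms.L2Operator MatrixOrder

variable {d g n : ℕ}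

/-! ### Hidden models and their cone -/

/-- The pair `(P, Z)` is a superposition of points `(H, t_1 H, …, t_g H)` with `H` positive
semidefinite and `t` in the cube `[-1, 1]^g`. -/
def HasHiddenModel (P : Matrix (Fin d) (Fin d) ℂ) (Z : Fin g → Matrix (Fin d) (Fin d) ℂ) : Prop :=
  ∃ (Λ : Type) (_ : Fintype Λ) (t : Fin g → Λ → ℝ) (H : Λ → Matrix (Fin d) (Fin d) ℂ),
    (∀ i l, t i l ∈ Set.Icc (-1 : ℝ) 1) ∧ (∀ l, (H l).PosSemidef) ∧ ∑ l, H l = P ∧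
      ∀ i, ∑ l, t i l • H l = Z i

theorem HasHiddenModel.congruence {P : Matrix (Fin d) (Fin d) ℂ}
    {Z : Fin g → Matrix (Fin d) (Fin d) ℂ} (h : HasHiddenModel P Z)
    (T : Matrix (Fin d) (Fin d) ℂ) :
    HasHiddenModel (Tᴴ * P * T) (fun i => Tᴴ * Z i * T) := by
  obtain ⟨Λ, _, t, H, ht, hH, rfl, hZ⟩ := h
  refine ⟨Λ, inferInstance, t, fun l => Tᴴ * H l * T, ht,
    fun l => (hH l).conjTranspose_mul_mul_same T, ?_, fun i => ?_⟩
  · simp [Finset.mul_sum, Finset.sum_mul]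
  · simp [← hZ, Finset.mul_sum, Finset.sum_mul]

theorem trace_mul_re_nonneg {A B : Matrix (Fin d) (Fin d) ℂ} (hA : A.PosSemidef)
    (hB : B.PosSemidef) : 0 ≤ (A * B).trace.re := by
  obtain ⟨C, rfl⟩ := CStarAlgebra.nonneg_iff_eq_star_mul_self.mp hB.nonneg
  rw [star_eq_conjTranspose, ← mul_assoc, trace_mul_comm, ← mul_assoc]
  exact (Complex.nonneg_iff.mp (hA.mul_mul_conjTranspose_same C).trace_nonneg).1

/-- Weak duality: `C - ∑ t i • B i` pairs nonnegatively with every `H` of the decomposition. -/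
theorem HasHiddenModel.sum_trace_le {P : Matrix (Fin d) (Fin d) ℂ}
    {Z : Fin g → Matrix (Fin d) (Fin d) ℂ} (h : HasHiddenModel P Z)
    {C : Matrix (Fin d) (Fin d) ℂ} {B : Fin g → Matrix (Fin d) (Fin d) ℂ}
    (hB : ∀ t : Fin g → ℝ, (∀ i, t i ∈ Set.Icc (-1 : ℝ) 1) →
      (C - ∑ i, t i • B i).PosSemidef) :
    ∑ i, (B i * Z i).trace.re ≤ (C * P).trace.re := by
  obtain ⟨Λ, _, t, H, ht, hH, rfl, hZ⟩ := h
  have key : ∀ l, 0 ≤ ((C - ∑ i, t i l • B i) * H l).trace.re := fun l =>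
    trace_mul_re_nonneg (hB _ fun i => ht i l) (hH l)
  have := Finset.sum_nonneg fun l (_ : l ∈ Finset.univ) => key l
  simp only [sub_mul, Finset.sum_mul, trace_sub, trace_sum, smul_mul_assoc, trace_smul,
    Complex.sub_re, Complex.re_sum, Complex.smul_re, Finset.sum_sub_distrib] at this
  simp only [← hZ, Finset.mul_sum, trace_sum, Complex.re_sum, mul_smul_comm, trace_smul,
    Complex.smul_re]
  rw [Finset.sum_comm]
  linarith

/-- The cone of superpositions with fixed coefficients `t`. -/
def hiddenCone {Λ : Type} [Fintype Λ] (t : Fin g → Λ → ℝ) :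
    Submodule NNReal (Matrix (Fin d) (Fin d) ℂ × (Fin g → Matrix (Fin d) (Fin d) ℂ)) where
  carrier := {x | ∃ H : Λ → Matrix (Fin d) (Fin d) ℂ, (∀ l, (H l).PosSemidef) ∧
    ∑ l, H l = x.1 ∧ ∀ i, ∑ l, t i l • H l = x.2 i}
  zero_mem' := ⟨0, fun _ => PosSemidef.zero, by simp, by simp⟩
  add_mem' := by
    rintro x y ⟨H, h1, h2, h3⟩ ⟨K, k1, k2, k3⟩
    exact ⟨H + K, fun l => (h1 l).add (k1 l), by simp [Finset.sum_add_distrib, h2, k2],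
      fun i => by simp [Finset.sum_add_distrib, h3, k3]⟩
  smul_mem' := by
    rintro c x ⟨H, h1, h2, h3⟩
    refine ⟨fun l => (c : ℝ) • H l, fun l => (h1 l).smul c.2, ?_, fun i => ?_⟩
    · rw [← Finset.smul_sum, h2]; rfl
    · simp_rw [smul_comm _ (c : ℝ)]
      rw [← Finset.smul_sum, h3]; rfl

/-- Each `H l` lies below the sum `x.1`, so the decompositions of a convergent sequence stay bounded
and a subsequence of them converges. -/
theorem isClosed_hiddenCone {Λ : Type} [Fintype Λ] (t : Fin g → Λ → ℝ) :
    IsClosed (SetLike.coe (hiddenCone (d := d) t)) := by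
  apply IsSeqClosed.isClosed
  intro x y hx hxy
  choose H h1 h2 h3 using hx
  obtain ⟨R, hR⟩ := (Metric.isBounded_range_of_tendsto x hxy).exists_norm_le
  have hb : ∀ k, H k ∈ Metric.closedBall (0 : Λ → Matrix (Fin d) (Fin d) ℂ) R := by
    intro k
    have hRk : ‖x k‖ ≤ R := hR _ ⟨k, rfl⟩
    rw [mem_closedBall_zero_iff, pi_norm_le_iff_of_nonneg ((norm_nonneg _).trans hRk)]
    intro l
    refine le_trans ?_ ((norm_fst_le (x k)).trans hRk)
    refine CStarAlgebra.norm_le_norm_of_nonneg_of_le (h1 k l).nonneg ?_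
    rw [← h2]
    exact Finset.single_le_sum (f := H k) (fun m _ => (h1 k m).nonneg) (Finset.mem_univ l)
  obtain ⟨K, -, φ, hφ, hK⟩ := tendsto_subseq_of_bounded Metric.isBounded_closedBall hb
  have hKl : ∀ l, Filter.Tendsto (fun k => H (φ k) l) Filter.atTop (nhds (K l)) := fun l =>
    (tendsto_pi_nhds.mp hK) l
  have hxφ := hxy.comp hφ.tendsto_atTop
  refine ⟨K, fun l => ?_, ?_, fun i => ?_⟩
  · exact (ge_of_tendsto' (hKl l) fun k => (h1 (φ k) l).nonneg).posSemidef
  · refine tendsto_nhds_unique (tendsto_finsetSum _ fun l _ => hKl l) ?_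
    simp_rw [h2]
    exact (continuous_fst.tendsto _).comp hxφ
  · refine tendsto_nhds_unique (tendsto_finsetSum _ fun l _ => (hKl l).const_smul (t i l)) ?_
    simp_rw [h3]
    exact (((continuous_apply i).comp continuous_snd).tendsto _).comp hxφ

/-! ### Separation by Hermitian matrices -/

/-- Every real linear functional on complex matrices is represented on Hermitian matrices by a
Hermitian matrix. -/
theorem exists_isHermitian_trace_eq (f : Matrix (Fin d) (Fin d) ℂ →ₗ[ℝ] ℝ) :
    ∃ B : Matrix (Fin d) (Fin d) ℂ, B.IsHermitian ∧
      ∀ H : Matrix (Fin d) (Fin d) ℂ, H.IsHermitian → f H = (B * H).trace.re := by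
  let A : Matrix (Fin d) (Fin d) ℂ := fun j i =>
    (f (single i j 1) : ℂ) - Complex.I * f (single i j Complex.I)
  have hA : ∀ H, f H = (A * H).trace.re := by
    intro H
    have hs : ∀ i j, single i j (H i j) =
        (H i j).re • single i j (1 : ℂ) + (H i j).im • single i j Complex.I := by
      intro i j
      rw [smul_single, smul_single, ← single_add]
      congr 1
      simp [Complex.re_add_im]
    conv_lhs => rw [matrix_eq_sum_single H]
    simp only [hs, map_sum, map_add, map_smul, smul_eq_mul, trace, diag, mul_apply,
      Complex.re_sum]
    rw [Finset.sum_comm]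
    refine Finset.sum_congr rfl fun j _ => Finset.sum_congr rfl fun i _ => ?_
    simp [A]
    ring
  -- On Hermitian `H`, `A` and `Aᴴ` give the same real trace, so the Hermitian part of `A` still
  -- represents `f`.
  refine ⟨(2⁻¹ : ℝ) • (A + Aᴴ), ?_, fun H hH => ?_⟩
  · simp [IsHermitian, conjTranspose_smul, add_comm]
  · have : (Aᴴ * H).trace.re = (A * H).trace.re := by
      rw [← Complex.conj_re, ← Complex.star_def, ← trace_conjTranspose, conjTranspose_mul,
        conjTranspose_conjTranspose, hH.eq, trace_mul_comm]
    rw [hA, smul_mul_assoc, trace_smul, Complex.smul_re, add_mul, trace_add, Complex.add_re, this]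
    simp
    ring

theorem posSemidef_iff_re_trace {M : Matrix (Fin d) (Fin d) ℂ} (hM : M.IsHermitian) :
    M.PosSemidef ↔ ∀ v : Fin d → ℂ, 0 ≤ (M * vecMulVec v (star v)).trace.re := by
  have h : ∀ v : Fin d → ℂ, (M * vecMulVec v (star v)).trace = star v ⬝ᵥ (M *ᵥ v) := by
    intro v
    rw [mul_vecMulVec, trace_vecMulVec, dotProduct_comm]
  refine ⟨fun hM v => ?_, fun hv => .of_dotProduct_mulVec_nonneg hM fun v => ?_⟩
  · rw [h]; exact hM.re_dotProduct_nonneg v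
  · rw [Complex.nonneg_iff, ← h]
    refine ⟨hv v, ?_⟩
    rw [h]
    exact (hM.im_star_dotProduct_mulVec_self v).symm

/-- **Duality**: a pair without a hidden model is separated from the pairs with such a model. -/
theorem exists_separation {P : Matrix (Fin d) (Fin d) ℂ}
    {Z : Fin g → Matrix (Fin d) (Fin d) ℂ} (hP : P.IsHermitian) (hZ : ∀ i, (Z i).IsHermitian)
    (h : ¬ HasHiddenModel P Z) :
    ∃ (C : Matrix (Fin d) (Fin d) ℂ) (B : Fin g → Matrix (Fin d) (Fin d) ℂ),
      (∀ i, (B i).IsHermitian) ∧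
      (∀ t : Fin g → ℝ, (∀ i, t i ∈ Set.Icc (-1 : ℝ) 1) → (C - ∑ i, t i • B i).PosSemidef) ∧
      (C * P).trace.re < ∑ i, (B i * Z i).trace.re := by
  -- The vertices of the cube suffice, and their finite number makes the cone closed.
  let t : Fin g → (Fin g → Bool) → ℝ := fun i e => if e i then 1 else -1
  let K : ProperCone ℝ (Matrix (Fin d) (Fin d) ℂ × (Fin g → Matrix (Fin d) (Fin d) ℂ)) :=
    ⟨hiddenCone t, isClosed_hiddenCone t⟩
  have hK : (P, Z) ∉ K := by
    rintro ⟨H, h1, h2, h3⟩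
    refine h ⟨_, inferInstance, t, H, fun i l => ?_, h1, h2, h3⟩
    dsimp only [t]; split_ifs <;> simp
  obtain ⟨f, hf, hfP⟩ := K.hyperplane_separation_point hK
  obtain ⟨C, hC, hfC⟩ := exists_isHermitian_trace_eq (f.toLinearMap ∘ₗ LinearMap.inl ℝ _ _)
  choose A hA hfA using fun i => exists_isHermitian_trace_eq
    (f.toLinearMap ∘ₗ LinearMap.inr ℝ _ _ ∘ₗ
      LinearMap.single ℝ (fun _ : Fin g => Matrix (Fin d) (Fin d) ℂ) i)
  have hfs : ∀ (Q : Matrix (Fin d) (Fin d) ℂ) (Y : Fin g → Matrix (Fin d) (Fin d) ℂ),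
      Q.IsHermitian → (∀ i, (Y i).IsHermitian) →
      f (Q, Y) = (C * Q).trace.re + ∑ i, (A i * Y i).trace.re := by
    intro Q Y hQ hY
    rw [← hfC Q hQ]
    simp_rw [← hfA _ _ (hY _)]
    have : (Q, Y) = (Q, 0) + ∑ i, ((0 : Matrix (Fin d) (Fin d) ℂ), Pi.single i (Y i)) := by
      ext1
      · simp [Prod.fst_sum]
      · simp [Prod.snd_sum, Finset.univ_sum_single]
    rw [this, map_add, map_sum]
    rfl
  refine ⟨C, fun i => -A i, fun i => (hA i).neg, fun s hs => ?_, ?_⟩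
  · rw [posSemidef_iff_re_trace]
    · intro v
      set V := vecMulVec v (star v) with hV
      have hVp : V.PosSemidef := posSemidef_vecMulVec_self_star v
      -- The vertex at which the linear function `t ↦ ∑ t i * Re tr (A i * V)` is minimal on the
      -- cube.
      let e : Fin g → Bool := fun i => decide ((A i * V).trace.re ≤ 0)
      have h0 := hf (V, fun i => t i e • V) ⟨fun l => if l = e then V else 0, fun l => by
        dsimp only
        split_ifs
        exacts [hVp, PosSemidef.zero], by simp, fun i => by simp⟩
      rw [hfs _ _ hVp.1 fun i => hVp.1.smul (.all _)] at h0
      simp only [mul_smul_comm, trace_smul, Complex.smul_re] at h0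
      simp only [smul_neg, Finset.sum_neg_distrib, sub_neg_eq_add, add_mul, Finset.sum_mul,
        trace_add, trace_sum, Complex.add_re, Complex.re_sum, smul_mul_assoc, trace_smul,
        Complex.smul_re]
      refine h0.trans (add_le_add_right (Finset.sum_le_sum fun i _ => ?_) _)
      have := hs i
      by_cases ha : (A i * V).trace.re ≤ 0
      · simp only [t, e, ha, decide_true, if_true, smul_eq_mul]
        nlinarith [this.2]
      · simp only [t, e, ha, decide_false, smul_eq_mul]
        norm_num
        nlinarith [this.1]
    · refine hC.sub (isSelfAdjoint_sum _ fun i _ => ?_)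
      exact (hA i).neg.smul (.all _)
  · rw [hfs P Z hP hZ] at hfP
    simp only [neg_mul, trace_neg, Complex.neg_re, Finset.sum_neg_distrib]
    linarith

/-! ### Free spectrahedra and the cube as trace inequalities -/

/-- Vectors of `ℂᵈ ⊗ ℂⁿ` are read as `n × d` matrices; the entries of `B` meet those of `Vᴴ X V` at
equal index pairs, whence the transpose. -/
theorem star_dotProduct_kronecker_mulVec (B : Matrix (Fin d) (Fin d) ℂ)
    (X : Matrix (Fin n) (Fin n) ℂ) (V : Matrix (Fin n) (Fin d) ℂ) :
    (star fun p : Fin d × Fin n => V p.2 p.1) ⬝ᵥ ((B ⊗ₖ X) *ᵥ fun p => V p.2 p.1) =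
      (Bᵀ * (Vᴴ * X * V)).trace := by
  simp only [dotProduct, mulVec, kroneckerMap_apply, trace, diag, mul_apply, transpose_apply,
    conjTranspose_apply, Fintype.sum_prod_type, Pi.star_apply, Finset.mul_sum, Finset.sum_mul]
  conv_rhs => rw [Finset.sum_comm]
  refine Finset.sum_congr rfl fun b _ => ?_
  rw [Finset.sum_comm]
  refine Finset.sum_congr rfl fun a _ => ?_
  rw [Finset.sum_comm]
  refine Finset.sum_congr rfl fun j _ => Finset.sum_congr rfl fun i _ => ?_
  ring

theorem mem_freeSpectrahedron_iff {B : Fin g → Matrix (Fin d) (Fin d) ℂ}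
    (hB : ∀ i, (B i).IsHermitian) {X : Fin g → Matrix (Fin n) (Fin n) ℂ}
    (hX : ∀ i, (X i).IsHermitian) :
    X ∈ freeSpectrahedron B n ↔ ∀ V : Matrix (Fin n) (Fin d) ℂ,
      ∑ i, ((B i)ᵀ * (Vᴴ * X i * V)).trace.re ≤ (Vᴴ * V).trace.re := by
  have hH : ((1 : Matrix (Fin d × Fin n) (Fin d × Fin n) ℂ) - ∑ i, B i ⊗ₖ X i).IsHermitian := by
    refine isHermitian_one.sub (isSelfAdjoint_sum _ fun i _ => ?_)
    rw [IsSelfAdjoint, star_eq_conjTranspose, conjTranspose_kronecker, (hB i).eq, (hX i).eq]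
  have key : ∀ V : Matrix (Fin n) (Fin d) ℂ,
      (star fun p : Fin d × Fin n => V p.2 p.1) ⬝ᵥ
        (((1 : Matrix (Fin d × Fin n) (Fin d × Fin n) ℂ) - ∑ i, B i ⊗ₖ X i) *ᵥ
          fun p => V p.2 p.1) =
      (Vᴴ * V).trace - ∑ i, ((B i)ᵀ * (Vᴴ * X i * V)).trace := by
    intro V
    have h1 := star_dotProduct_kronecker_mulVec (1 : Matrix (Fin d) (Fin d) ℂ)
      (1 : Matrix (Fin n) (Fin n) ℂ) V
    rw [one_kronecker_one, transpose_one, one_mul, Matrix.mul_one] at h1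
    rw [sub_mulVec, dotProduct_sub, h1, sum_mulVec, dotProduct_sum]
    simp_rw [star_dotProduct_kronecker_mulVec]
  constructor
  · intro h V
    have := h.2.re_dotProduct_nonneg fun p => V p.2 p.1
    rw [key] at this
    simpa using this
  · refine fun h => ⟨hX, .of_dotProduct_mulVec_nonneg hH fun v => ?_⟩
    rw [Complex.nonneg_iff]
    refine ⟨?_, (hH.im_star_dotProduct_mulVec_self v).symm⟩
    have := key (of fun j a => v (a, j))
    simp only [of_apply, Prod.mk.eta] at this
    rw [this]
    simpa using h (of fun j a => v (a, j))

theorem norm_toEuclideanCLM_le_one_iff {X : Matrix (Fin n) (Fin n) ℂ} (hX : X.IsHermitian) :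
    ‖toEuclideanCLM (𝕜 := ℂ) X‖ ≤ 1 ↔ (1 - X).PosSemidef ∧ (1 + X).PosSemidef := by
  rw [← cstar_norm_def]
  constructor
  · intro h
    have h1 : algebraMap ℝ (Matrix (Fin n) (Fin n) ℂ) ‖X‖ ≤ 1 := by
      simpa using algebraMap_mono (Matrix (Fin n) (Fin n) ℂ) h
    refine ⟨(IsSelfAdjoint.le_algebraMap_norm_self hX).trans h1, ?_⟩
    have h2 := (IsSelfAdjoint.le_algebraMap_norm_self hX.neg).trans ((norm_neg X).symm ▸ h1)
    rw [le_iff, sub_neg_eq_add] at h2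
    exact h2
  · rintro ⟨h1, h2⟩
    -- The factors commute, so the sum is `(1 - X²)((1 + X) + (1 - X))`.
    have h3 := (h1.mul_mul_conjTranspose_same (1 + X)).add (h2.mul_mul_conjTranspose_same (1 - X))
    have h4 : (1 + X) * (1 - X) * (1 + X)ᴴ + (1 - X) * (1 + X) * (1 - X)ᴴ =
        (2 : ℝ) • (1 - star X * X) := by
      rw [h1.1.eq, h2.1.eq, star_eq_conjTranspose, hX.eq, two_smul]
      noncomm_ring
    rw [h4] at h3
    have h5 : (1 - star X * X).PosSemidef := by
      have := h3.smul (a := (2⁻¹ : ℝ)) (by norm_num)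
      rwa [smul_smul, inv_mul_cancel₀ two_ne_zero, one_smul] at this
    have h6 := (CStarAlgebra.norm_le_one_iff_of_nonneg (star X * X) (star_mul_self_nonneg X)).2 h5
    rw [CStarRing.norm_star_mul_self] at h6
    nlinarith [norm_nonneg X]

theorem matrixCube_one_subset_iff {B : Fin g → Matrix (Fin d) (Fin d) ℂ}
    (hB : ∀ i, (B i).IsHermitian) :
    matrixCube g 1 ⊆ freeSpectrahedron B 1 ↔ ∀ t : Fin g → ℝ,
      (∀ i, t i ∈ Set.Icc (-1 : ℝ) 1) → (1 - ∑ i, t i • (B i)ᵀ).PosSemidef := by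
  constructor
  · intro h t ht
    have hX : ∀ i, (t i • (1 : Matrix (Fin 1) (Fin 1) ℂ)).IsHermitian := fun i =>
      isHermitian_one.smul (.all _)
    have hmem : (fun i => t i • (1 : Matrix (Fin 1) (Fin 1) ℂ)) ∈ matrixCube g 1 := by
      refine fun i => ⟨hX i, (norm_toEuclideanCLM_le_one_iff (hX i)).2 ⟨?_, ?_⟩⟩
      · simpa [sub_smul] using
          (PosSemidef.one (n := Fin 1) (R := ℂ)).smul (sub_nonneg.2 (ht i).2)
      · rw [← one_smul ℝ (1 : Matrix (Fin 1) (Fin 1) ℂ), smul_smul, mul_one, ← add_smul]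
        exact PosSemidef.one.smul (neg_le_iff_add_nonneg'.1 (ht i).1)
    rw [posSemidef_iff_re_trace (isHermitian_one.sub
      (isSelfAdjoint_sum _ fun i _ => (hB i).transpose.smul (.all _)))]
    intro v
    have := (mem_freeSpectrahedron_iff hB hX).1 (h hmem) (replicateRow (Fin 1) (star v))
    have hv : (replicateRow (Fin 1) (star v))ᴴ * replicateRow (Fin 1) (star v) =
        vecMulVec v (star v) := by
      ext; simp [mul_apply, vecMulVec_apply]
    simp only [Matrix.mul_smul, Matrix.smul_mul, Matrix.mul_one, hv, trace_smul,
      Complex.smul_re] at this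
    simpa only [sub_mul, one_mul, Finset.sum_mul, smul_mul_assoc, trace_sub, trace_sum, trace_smul,
      Complex.sub_re, Complex.re_sum, Complex.smul_re, sub_nonneg] using this
  · intro h X hX
    rw [mem_freeSpectrahedron_iff hB fun i => (hX i).1]
    intro V
    have hXt : ∀ i, X i = (X i 0 0).re • (1 : Matrix (Fin 1) (Fin 1) ℂ) := by
      intro i
      ext a b
      rw [Subsingleton.elim a 0, Subsingleton.elim b 0]
      have := (hX i).1.coe_re_apply_self 0
      simpa using this.symm
    have ht : ∀ i, (X i 0 0).re ∈ Set.Icc (-1 : ℝ) 1 := by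
      intro i
      obtain ⟨h1, h2⟩ := (norm_toEuclideanCLM_le_one_iff (hX i).1).1 (hX i).2
      have h3 := (Complex.nonneg_iff.1 (h1.diag_nonneg (i := 0))).1
      have h4 := (Complex.nonneg_iff.1 (h2.diag_nonneg (i := 0))).1
      simp at h3 h4
      constructor <;> linarith
    have := trace_mul_re_nonneg (h _ ht) (posSemidef_conjTranspose_mul_self V)
    have e : ∀ i, Vᴴ * X i * V = (X i 0 0).re • (Vᴴ * V) := by
      intro i
      conv_lhs => rw [hXt i]
      simp
    simp_rw [e]
    simpa [sub_mul, Finset.sum_mul] using this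

/-! ### Assemblages as pairs -/

/-- The dictionary is `H = q τ`, `t = p(0) - p(1)`, with inverse `q = tr H`, `p = (1 ± t) / 2`. -/
theorem mem_lhsAssemblages_iff {P : Matrix (Fin d) (Fin d) ℂ} (hP : IsDensityMatrix P)
    {σ : Family g (fun _ => 2) d} (hσ : σ ∈ assemblages g (fun _ => 2) d P) :
    σ ∈ lhsAssemblages g (fun _ => 2) d P ↔ HasHiddenModel P fun x => σ x 0 - σ x 1 := by
  constructor
  · rintro ⟨-, Λ, _, q, p, τ, hq, -, hp, hp1, hτ, hs, hP⟩
    refine ⟨Λ, inferInstance, fun x l => p x 0 l - p x 1 l, fun l => q l • τ l, fun x l => ?_,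
      fun l => (hτ l).1.smul (hq l), hP, fun x => ?_⟩
    · have h1 := hp1 x l
      rw [Fin.sum_univ_two] at h1
      have h2 := hp x 0 l
      have h3 := hp x 1 l
      constructor <;> linarith
    · dsimp only
      rw [hs, hs, ← Finset.sum_sub_distrib]
      refine Finset.sum_congr rfl fun l _ => ?_
      rw [smul_smul, ← sub_smul]
      ring_nf
  · rintro ⟨Λ, _, t, H, ht, hH, hHP, hZ⟩
    have hq0 : ∀ l, 0 ≤ (H l).trace.re := fun l =>
      (Complex.nonneg_iff.1 (hH l).trace_nonneg).1
    have hqc : ∀ l, ((H l).trace.re : ℂ) = (H l).trace := fun l => by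
      apply Complex.ext
      · simp
      · simpa using (Complex.nonneg_iff.1 (hH l).trace_nonneg).2
    -- If the trace vanishes, so does `H l`, and any density matrix serves as the state.
    let τ : Λ → Matrix (Fin d) (Fin d) ℂ := fun l =>
      if (H l).trace.re = 0 then P else (H l).trace.re⁻¹ • H l
    have hτ : ∀ l, (H l).trace.re • τ l = H l := by
      intro l
      by_cases h0 : (H l).trace.re = 0
      · have : H l = 0 := (hH l).trace_eq_zero_iff.1 (by rw [← hqc, h0, Complex.ofReal_zero])
        simp [this]
      · simp [τ, h0, smul_smul]
    have hPs : ∑ l, (H l).trace.re • τ l = P := by simp_rw [hτ, hHP]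
    refine ⟨hσ.1, Λ, inferInstance, fun l => (H l).trace.re,
      fun x a l => (1 + (if a = 0 then 1 else -1) * t x l) / 2, τ, hq0, ?_, fun x a l => ?_,
      fun x l => ?_, fun l => ?_, fun x a => ?_, hPs⟩
    · rw [← Complex.re_sum, ← trace_sum, hHP, hP.2, Complex.one_re]
    · have := ht x l
      dsimp only
      split_ifs <;> linarith [this.1, this.2]
    · rw [Fin.sum_univ_two]
      norm_num
      ring
    · by_cases h0 : (H l).trace.re = 0
      · simpa [τ, h0] using hP
      · simp only [τ, h0, if_false]
        refine ⟨(hH l).smul (inv_nonneg.2 (hq0 l)), ?_⟩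
        rw [trace_smul, Complex.real_smul]
        nth_rewrite 2 [← hqc]
        rw [← Complex.ofReal_mul, inv_mul_cancel₀ h0, Complex.ofReal_one]
    · have h2 : ∀ l, ((H l).trace.re * ((1 + (if a = 0 then 1 else -1) * t x l) / 2)) • τ l =
          (2⁻¹ : ℝ) • (H l + (if a = 0 then 1 else -1 : ℝ) • t x l • H l) := by
        intro l
        rw [mul_comm, ← smul_smul, hτ]
        module
      simp_rw [h2]
      rw [← Finset.smul_sum, Finset.sum_add_distrib, ← Finset.smul_sum, hHP, hZ, ← hσ.2 x,
        Fin.sum_univ_two]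
      fin_cases a
      · simp only [Fin.zero_eta, if_true]; module
      · simp; module

theorem mix_mem_assemblages {P : Matrix (Fin d) (Fin d) ℂ} {s : Fin g → ℝ}
    (hs : ∀ x, s x ∈ Set.Icc (0 : ℝ) 1) (hP : P.PosSemidef) {σ : Family g (fun _ => 2) d}
    (hσ : σ ∈ assemblages g (fun _ => 2) d P) :
    mix s σ (trivialAssemblage g (fun _ => 2) d P) ∈ assemblages g (fun _ => 2) d P := by
  refine ⟨fun x a => ((hσ.1 x a).smul (hs x).1).add
    ((hP.smul (by positivity)).smul (sub_nonneg.2 (hs x).2)), fun x => ?_⟩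
  have := hσ.2 x
  simp only [Fin.sum_univ_two, mix, trivialAssemblage] at this ⊢
  rw [← this]
  push_cast
  module

/-- In terms of the differences `Y x = σ_{0|x} - σ_{1|x}`, the noisy assemblages have local hidden
state models if and only if the pairs `(σbar, s.Y)` have hidden models. -/
theorem mix_subset_iff {P : Matrix (Fin d) (Fin d) ℂ} (hP : IsDensityMatrix P) {s : Fin g → ℝ}
    (hs : ∀ x, s x ∈ Set.Icc (0 : ℝ) 1) :
    (fun σ => mix s σ (trivialAssemblage g (fun _ => 2) d P)) ''
        assemblages g (fun _ => 2) d P ⊆ lhsAssemblages g (fun _ => 2) d P ↔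
      ∀ Y : Fin g → Matrix (Fin d) (Fin d) ℂ,
        (∀ i, (P - Y i).PosSemidef) → (∀ i, (P + Y i).PosSemidef) →
          HasHiddenModel P fun i => s i • Y i := by
  have key : ∀ σ ∈ assemblages g (fun _ => 2) d P,
      mix s σ (trivialAssemblage g (fun _ => 2) d P) ∈ lhsAssemblages g (fun _ => 2) d P ↔
        HasHiddenModel P fun i => s i • (σ i 0 - σ i 1) := by
    intro σ hσ
    rw [mem_lhsAssemblages_iff hP (mix_mem_assemblages hs hP.1 hσ)]
    simp [mix, trivialAssemblage, smul_sub]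
  rw [Set.image_subset_iff]
  constructor
  · intro h Y h1 h2
    let σ : Family g (fun _ => 2) d := fun x a =>
      if a = 0 then (2⁻¹ : ℝ) • (P + Y x) else (2⁻¹ : ℝ) • (P - Y x)
    have hσ : σ ∈ assemblages g (fun _ => 2) d P := by
      refine ⟨fun x a => ?_, fun x => ?_⟩
      · dsimp only [σ]
        split_ifs
        exacts [(h2 x).smul (by norm_num), (h1 x).smul (by norm_num)]
      · simp only [Fin.sum_univ_two, σ, if_true, one_ne_zero, if_false]
        module
    have e : ∀ i, σ i 0 - σ i 1 = Y i := by
      intro i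
      simp only [σ, if_true, one_ne_zero, if_false]
      module
    simpa only [e] using (key σ hσ).1 (h hσ)
  · intro h σ hσ
    refine (key σ hσ).2 (h _ (fun i => ?_) fun i => ?_)
    · have : P - (σ i 0 - σ i 1) = (2 : ℝ) • σ i 1 := by
        rw [← hσ.2 i, Fin.sum_univ_two]; module
      rw [this]
      exact (hσ.1 i 1).smul (by norm_num)
    · have : P + (σ i 0 - σ i 1) = (2 : ℝ) • σ i 0 := by
        rw [← hσ.2 i, Fin.sum_univ_two]; module
      rw [this]
      exact (hσ.1 i 0).smul (by norm_num)

/-! ### The two inclusions by congruence -/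

theorem PosDef.exists_isUnit_eq {P : Matrix (Fin d) (Fin d) ℂ} (hP : P.PosDef) :
    ∃ E : Matrix (Fin d) (Fin d) ℂ, IsUnit E ∧ P = Eᴴ * E :=
  CStarAlgebra.isStrictlyPositive_iff_eq_star_mul_self.1 (isStrictlyPositive_iff_posDef.2 hP)

/-- An inclusion constant of the cube yields hidden models for all noisy pairs. -/
theorem hasHiddenModel_of_mem_cubeInclusionConstants {P : Matrix (Fin d) (Fin d) ℂ}
    (hP : P.PosDef) {s : Fin g → ℝ} (hs : s ∈ cubeInclusionConstants g d)
    {Y : Fin g → Matrix (Fin d) (Fin d) ℂ} (h1 : ∀ i, (P - Y i).PosSemidef)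
    (h2 : ∀ i, (P + Y i).PosSemidef) : HasHiddenModel P fun i => s i • Y i := by
  by_contra hno
  have hY : ∀ i, (Y i).IsHermitian := fun i => by
    simpa using (h2 i).1.sub hP.1
  obtain ⟨C, B, hB, hCB, hlt⟩ :=
    exists_separation hP.1 (fun i => (hY i).smul (.all (s i))) hno
  have hC : C.PosSemidef := by simpa using hCB 0 (by simp)
  -- `C` may be singular; the strict separation leaves room for `C + δ • 1`.
  obtain ⟨δ, hδ, hδlt⟩ : ∃ δ : ℝ, 0 < δ ∧
      (C * P).trace.re + δ * P.trace.re < ∑ i, (B i * s i • Y i).trace.re := by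
    have hc : Filter.Tendsto (fun δ : ℝ => (C * P).trace.re + δ * P.trace.re)
        (nhdsWithin 0 (Set.Ioi 0)) (nhds ((C * P).trace.re + 0 * P.trace.re)) :=
      (Continuous.tendsto (by fun_prop) 0).mono_left nhdsWithin_le_nhds
    rw [zero_mul, add_zero] at hc
    obtain ⟨δ, h, hδ⟩ := ((hc.eventually_lt_const hlt).and self_mem_nhdsWithin).exists
    exact ⟨δ, hδ, h⟩
  have hδ1 : (δ • (1 : Matrix (Fin d) (Fin d) ℂ)).PosDef := PosDef.one.smul hδ
  obtain ⟨D, hD, hDC⟩ := PosDef.exists_isUnit_eq (PosDef.posSemidef_add hC hδ1)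
  obtain ⟨E, hE, hEP⟩ := PosDef.exists_isUnit_eq hP
  have hDd := (isUnit_iff_isUnit_det D).1 hD
  have hEd := (isUnit_iff_isUnit_det E).1 hE
  have cancel : ∀ {F : Matrix (Fin d) (Fin d) ℂ}, IsUnit F.det → ∀ M,
      Fᴴ * ((F⁻¹)ᴴ * M * F⁻¹) * F = M := by
    intro F hF M
    have hF' : Fᴴ * (F⁻¹)ᴴ = 1 := by
      rw [← conjTranspose_mul, nonsing_inv_mul _ hF, conjTranspose_one]
    calc Fᴴ * ((F⁻¹)ᴴ * M * F⁻¹) * F = (Fᴴ * (F⁻¹)ᴴ) * M * (F⁻¹ * F) := by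
          simp only [mul_assoc]
      _ = M := by rw [hF', nonsing_inv_mul _ hF, one_mul, mul_one]
  have unit : ∀ {F : Matrix (Fin d) (Fin d) ℂ}, IsUnit F.det →
      (F⁻¹)ᴴ * (Fᴴ * F) * F⁻¹ = 1 := by
    intro F hF
    have hF' : (F⁻¹)ᴴ * Fᴴ = 1 := by
      rw [← conjTranspose_mul, mul_nonsing_inv _ hF, conjTranspose_one]
    rw [← mul_assoc, hF', one_mul, mul_nonsing_inv _ hF]
  set B' : Fin g → Matrix (Fin d) (Fin d) ℂ := fun i => (D⁻¹)ᴴ * B i * D⁻¹ with hB'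
  set X : Fin g → Matrix (Fin d) (Fin d) ℂ := fun i => (E⁻¹)ᴴ * Y i * E⁻¹ with hX'
  have hB'h : ∀ i, (B' i).IsHermitian := fun i => isHermitian_conjTranspose_mul_mul _ (hB i)
  have hXh : ∀ i, (X i).IsHermitian := fun i => isHermitian_conjTranspose_mul_mul _ (hY i)
  have hBt : ∀ i, ((B' i)ᵀ).IsHermitian := fun i => (hB'h i).transpose
  have hcube : X ∈ matrixCube g d := by
    refine fun i => ⟨hXh i, (norm_toEuclideanCLM_le_one_iff (hXh i)).2 ⟨?_, ?_⟩⟩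
    · have := (h1 i).conjTranspose_mul_mul_same E⁻¹
      rwa [mul_sub, sub_mul, hEP, unit hEd] at this
    · have := (h2 i).conjTranspose_mul_mul_same E⁻¹
      rwa [mul_add, add_mul, hEP, unit hEd] at this
  have hsub : matrixCube g 1 ⊆ freeSpectrahedron (fun i => (B' i)ᵀ) 1 := by
    rw [matrixCube_one_subset_iff hBt]
    intro t ht
    have := ((hCB t ht).add hδ1.posSemidef).conjTranspose_mul_mul_same D⁻¹
    rw [sub_add_eq_add_sub, hDC, mul_sub, sub_mul, unit hDd] at this
    simpa [hB', Finset.mul_sum, Finset.sum_mul] using this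
  -- For `V = E Dᴴ` the congruences cancel under the trace: `tr (Vᴴ V) = tr ((C + δ) P)`, and the
  -- left side becomes `∑ tr (B i * s i • Y i)`. Level `n = d` is enough.
  have hfin := (mem_freeSpectrahedron_iff hBt fun i => (hXh i).smul (.all (s i))).1
    (hs.2 _ hBt hsub d ⟨X, hcube, rfl⟩) (E * Dᴴ)
  have e1 : ∀ i, ((B' i) * ((E * Dᴴ)ᴴ * (s i • X i) * (E * Dᴴ))).trace =
      (B i * s i • Y i).trace := by
    intro i
    conv_rhs => rw [← cancel hDd (B i), ← cancel hEd (Y i)]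
    simp only [conjTranspose_mul, conjTranspose_conjTranspose, mul_smul_comm, smul_mul_assoc,
      trace_smul]
    congr 1
    simp only [hB', hX', mul_assoc]
    rw [trace_mul_comm Dᴴ]
    simp only [mul_assoc]
  have e2 : ((E * Dᴴ)ᴴ * (E * Dᴴ)).trace.re = (C * P).trace.re + δ * P.trace.re := by
    have : ((E * Dᴴ)ᴴ * (E * Dᴴ)).trace = ((C + δ • 1) * P).trace := by
      rw [hDC, hEP, conjTranspose_mul, conjTranspose_conjTranspose, mul_assoc Dᴴ,
        trace_mul_comm Dᴴ]
      simp only [mul_assoc]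
    rw [this, add_mul, trace_add, smul_mul_assoc, one_mul, trace_smul]
    simp
  simp only [transpose_transpose, e1] at hfin
  rw [e2] at hfin
  exact absurd hfin (not_le.2 hδlt)

/-- Noise levels for which all noisy pairs have hidden models are inclusion constants. -/
theorem mem_cubeInclusionConstants_of_hasHiddenModel {P : Matrix (Fin d) (Fin d) ℂ}
    (hP : P.PosDef) {s : Fin g → ℝ} (hs : ∀ i, s i ∈ Set.Icc (0 : ℝ) 1)
    (h : ∀ Y : Fin g → Matrix (Fin d) (Fin d) ℂ,
        (∀ i, (P - Y i).PosSemidef) → (∀ i, (P + Y i).PosSemidef) →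
          HasHiddenModel P fun i => s i • Y i) :
    s ∈ cubeInclusionConstants g d := by
  refine ⟨hs, fun B hB hsub n => ?_⟩
  rintro _ ⟨X, hX, rfl⟩
  rw [matrixCube_one_subset_iff hB] at hsub
  rw [mem_freeSpectrahedron_iff hB fun i => (hX i).1.smul (.all (s i))]
  intro V
  -- `Vᴴ V` may be singular; adding `δ • 1` costs its trace `δ * d`, which vanishes in the limit.
  have main : ∀ δ : ℝ, 0 < δ → ∑ i, ((B i)ᵀ * (Vᴴ * (s i • X i) * V)).trace.re ≤
      (Vᴴ * V).trace.re + δ * d := by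
    intro δ hδ
    have hδ1 : (δ • (1 : Matrix (Fin d) (Fin d) ℂ)).PosDef := PosDef.one.smul hδ
    obtain ⟨D, hD, hDQ⟩ := PosDef.exists_isUnit_eq
      (PosDef.posSemidef_add (posSemidef_conjTranspose_mul_self V) hδ1)
    obtain ⟨E, hE, hEP⟩ := PosDef.exists_isUnit_eq hP
    have hDd := (isUnit_iff_isUnit_det D).1 hD
    have hEd := (isUnit_iff_isUnit_det E).1 hE
    have conv : ∀ {F G : Matrix (Fin d) (Fin d) ℂ}, IsUnit F.det →
        (F⁻¹ * G)ᴴ * (Fᴴ * F) * (F⁻¹ * G) = Gᴴ * G := by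
      intro F G hF
      rw [mul_assoc, mul_assoc, ← mul_assoc F, mul_nonsing_inv _ hF, one_mul, ← mul_assoc,
        ← conjTranspose_mul, ← mul_assoc, mul_nonsing_inv _ hF, one_mul]
    have hYQ : ∀ i, ((Vᴴ * V + δ • 1) - Vᴴ * X i * V).PosSemidef ∧
        ((Vᴴ * V + δ • 1) + Vᴴ * X i * V).PosSemidef := by
      intro i
      obtain ⟨h1, h2⟩ := (norm_toEuclideanCLM_le_one_iff (hX i).1).1 (hX i).2
      constructor
      · have := (h1.conjTranspose_mul_mul_same V).add hδ1.posSemidef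
        rwa [Matrix.mul_sub, Matrix.sub_mul, Matrix.mul_one, sub_add_eq_add_sub] at this
      · have := (h2.conjTranspose_mul_mul_same V).add hδ1.posSemidef
        rwa [Matrix.mul_add, Matrix.add_mul, Matrix.mul_one, add_right_comm] at this
    -- Congruence by `D⁻¹ E` takes `Vᴴ V + δ • 1 = Dᴴ D` to `Eᴴ E = P`, where the hypothesis
    -- applies; `E⁻¹ D` then takes the model back.
    have hmodel := h (fun i => (D⁻¹ * E)ᴴ * (Vᴴ * X i * V) * (D⁻¹ * E))
      (fun i => by
        have := (hYQ i).1.conjTranspose_mul_mul_same (D⁻¹ * E)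
        rwa [mul_sub, sub_mul, hDQ, conv hDd, ← hEP] at this)
      (fun i => by
        have := (hYQ i).2.conjTranspose_mul_mul_same (D⁻¹ * E)
        rwa [mul_add, add_mul, hDQ, conv hDd, ← hEP] at this)
    have hback := hmodel.congruence (E⁻¹ * D)
    have hinv : (D⁻¹ * E) * (E⁻¹ * D) = 1 := by
      rw [mul_assoc, ← mul_assoc E, mul_nonsing_inv _ hEd, one_mul, nonsing_inv_mul _ hDd]
    have hinv' : (E⁻¹ * D)ᴴ * (D⁻¹ * E)ᴴ = 1 := by
      rw [← conjTranspose_mul, hinv, conjTranspose_one]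
    have e : ∀ i, (E⁻¹ * D)ᴴ * (s i • ((D⁻¹ * E)ᴴ * (Vᴴ * X i * V) * (D⁻¹ * E))) * (E⁻¹ * D) =
        Vᴴ * (s i • X i) * V := by
      intro i
      simp only [Matrix.mul_smul, Matrix.smul_mul]
      congr 1
      calc (E⁻¹ * D)ᴴ * ((D⁻¹ * E)ᴴ * (Vᴴ * X i * V) * (D⁻¹ * E)) * (E⁻¹ * D)
          = ((E⁻¹ * D)ᴴ * (D⁻¹ * E)ᴴ) * (Vᴴ * X i * V) * ((D⁻¹ * E) * (E⁻¹ * D)) := by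
            simp only [mul_assoc]
        _ = Vᴴ * X i * V := by rw [hinv, hinv', one_mul, mul_one]
    simp only [e] at hback
    rw [hEP, conv hEd, ← hDQ] at hback
    have := hback.sum_trace_le hsub
    simpa using this
  have hlim : Filter.Tendsto (fun δ : ℝ => (Vᴴ * V).trace.re + δ * d)
      (nhdsWithin 0 (Set.Ioi 0)) (nhds ((Vᴴ * V).trace.re + 0 * d)) :=
    (Continuous.tendsto (by fun_prop) 0).mono_left nhdsWithin_le_nhds
  rw [zero_mul, add_zero] at hlim
  exact ge_of_tendsto hlim (Filter.eventually_of_mem self_mem_nhdsWithin main)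

end Steering

theorem mainTheorem10 (g d : ℕ) (σbar : Matrix (Fin d) (Fin d) ℂ)
    (hσ : Steering.IsDensityMatrix σbar) (hinv : IsUnit σbar) :
    {s : Fin g → ℝ | (∀ x, s x ∈ Set.Icc (0 : ℝ) 1) ∧
      (fun σ => Steering.mix s σ (Steering.trivialAssemblage g (fun _ => 2) d σbar)) ''
          Steering.assemblages g (fun _ => 2) d σbar ⊆
        Steering.lhsAssemblages g (fun _ => 2) d σbar} =
      Steering.cubeInclusionConstants g d := by
  have hP : σbar.PosDef := hσ.1.posDef_iff_isUnit.2 hinv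
  ext s
  constructor
  · rintro ⟨hs, h⟩
    exact Steering.mem_cubeInclusionConstants_of_hasHiddenModel hP hs
      ((Steering.mix_subset_iff hσ hs).1 h)
  · intro h
    exact ⟨h.1, (Steering.mix_subset_iff hσ h.1).2 fun Y =>
      Steering.hasHiddenModel_of_mem_cubeInclusionConstants hP h⟩
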